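/- **Setting.** Let $F:\mathbb R^d\times\mathbb R^s\to\mathbb R$ be locally Lipschitz, let $G:\mathbb R^d\times\mathbb R^s\to\mathbb R^p$, $H:\mathbb R^d\times\mathbb R^s\to\mathbb R^q$, $f:\mathbb R^d\times\mathbb R^s\to\mathbb R$, $g:\mathbb R^d\times\mathbb R^s\to\mathbb R^m$, $h:\mathbb R^d\times\mathbb R^s\to\mathbb R^n$ be continuously differentiable, and let the partial gradients $\nabla_y f,\nabla_y g_i,\nabla_y h_j$ be continuously differentiable in $(x,y)$. Put $Y(x)=\{y: g(x,y)\le 0,\ h(x,y)=0\}$, $V(x)=\inf_{y\in Y(x)}f(x,y)\in[-\infty,\infty]$, $\nabla_yL(x,y,u,v)=\nabla_y f(x,y)+\sum_i u_i\nabla_y g_i(x,y)+\sum_j v_j\nabla_y h_j(x,y)$, $\Omega=\{(a,b)\in\mathbb R^2: 0\le a\perp b\ge 0\}$. The combined program is $$(\mathrm{CP})\quad \min_{x,y,u,v} F(x,y)\ \text{ s.t. } f(x,y)-V(x)\le 0,\ G(x,y)\le 0,\ H(x,y)=0,\ h(x,y)=0,\ \nabla_yL(x,y,u,v)=0,\ (-g_i(x,y),u_i)\in\Omega\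 (1\le i\le m).$$ **Subdifferential, RCPLD and M-stationarity.** For $\varphi:\mathbb R^N\to\mathbb R$, $\widehat\partial\varphi(z)$ is the set of $\zeta$ with $\varphi(z')-\varphi(z)-\langle\zeta,z'-z\rangle\ge o(\|z'-z\|)$ as $z'\to z$, and $\partial\varphi(z)$ is the set of limits of $\xi_k\in\widehat\partial\varphi(z_k)$ with $z_k\to z$, $\varphi(z_k)\to\varphi(z)$. Consider on $\mathbb R^N$ a system $\tilde g_i\le 0$, $\tilde h_j=0$, $(\tilde G_i,\tilde H_i)\in\Omega$, a feasible point $z^*$, and the index sets $A=\{\tilde g_i(z^*)=0\}$, $I=\{\tilde G_i(z^*)=0<\tilde H_i(z^*)\}$, $J=\{\tilde G_i(z^*)=\tilde H_i(z^*)=0\}$, $K=\{\tilde G_i(z^*)>0=\tilde H_i(z^*)\}$. *RCPLD* holds at $z^*$ if (i) the rank of the family consisting of all $\nabla\tilde h_j(z)$, the $\nabla\tilde G_i(z)$, $i\in I$, and the $\nabla\tilde H_i(z)$, $i\in K$, is constant for $z$ near $z^*$; and (ii) the following holds whenever $I_1$ is a set of indices $j$, $I_2\subseteq I$, $I_3\subseteq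 K$ are such that $\nabla\tilde h_j(z^*)$ ($j\in I_1$), $\nabla\tilde G_i(z^*)$ ($i\in I_2$), $\nabla\tilde H_i(z^*)$ ($i\in I_3$) form a basis of the span of the family in (i) at $z^*$, and $I_4\subseteq A$, $I_5,I_6\subseteq J$. If $$0=\sum_{i\in I_4}\lambda^g_iv^*_i+\sum_{j\in I_1}\lambda^h_j\nabla\tilde h_j(z^*)-\sum_{i\in I_2\cup I_5}\lambda^G_i\nabla\tilde G_i(z^*)-\sum_{i\in I_3\cup I_6}\lambda^H_i\nabla\tilde H_i(z^*)$$ with $v_i^*\in\partial\tilde g_i(z^*)$ and $\lambda_i^g\ge0$ for $i\in I_4$, with, for each $i\in J$, either $\lambda^G_i,\lambda^H_i>0$ or $\lambda^G_i\lambda^H_i=0$, and with the multipliers occurring in this sum not all zero, then for all sequences $z^k\to z^*$, $z^k\ne z^*$, and $v_i^k\in\partial\tilde g_i(z^k)$, $v_i^k\to v_i^*$ ($i\in I_4$), the family $v_i^k$ ($i\in I_4$), $\nabla\tilde h_j(z^k)$ ($j\in I_1$), $\nabla\tilde G_i(z^k)$ ($i\in I_2\cup I_5$), $\nabla\tilde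 H_i(z^k)$ ($i\in I_3\cup I_6$) is linearly dependent for all sufficiently large $k$. The point $z^*$ is *M-stationary* for minimizing $\varphi$ over the system if there are $\lambda_i^g\ge0$ ($i\in A$) and real $\lambda^h_j,\lambda^G_i,\lambda^H_i$ such that $$0\in\partial\varphi(z^*)+\sum_{i\in A}\lambda_i^g\partial\tilde g_i(z^*)+\sum_j\lambda_j^h\nabla\tilde h_j(z^*)-\sum_{i\in I\cup J}\lambda_i^G\nabla\tilde G_i(z^*)-\sum_{i\in K\cup J}\lambda^H_i\nabla\tilde H_i(z^*),$$ with $\lambda^H_i=0$ for $i\in I$, $\lambda^G_i=0$ for $i\in K$, and either $\lambda^G_i,\lambda^H_i>0$ or $\lambda^G_i\lambda^H_i=0$ for $i\in J$. For (CP) these notions are used in the variable $z=(x,y,u,v)$ with $\varphi(z)=F(x,y)$, $\tilde g=(f-V,G)$, $\tilde h=(H,h,\nabla_yL)$, $\tilde G=-g$, $\tilde H(z)=u$. **Theorem.** Let $(x^*,y^*,u^*,v^*)$ be a local solution of (CP) and suppose that $V$ is finite and Lipschitz continuous on a neighbourhood of $x^*$. Let $\mathcal I^*=\{i:g_i(x^*,y^*)=0,u_i^*>0\}$,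 $\mathcal J^*=\{i:g_i(x^*,y^*)=0,u^*_i=0\}$, $\mathcal K^*=\{i:g_i(x^*,y^*)<0,u_i^*=0\}$. If the matrix $$J^*=\begin{bmatrix}\nabla(\nabla_yf+u^*\nabla_yg+v^*\nabla_yh)(x^*,y^*)&\nabla_yh(x^*,y^*)^T&\nabla_yg_{\mathcal I^*\cup\mathcal J^*}(x^*,y^*)^T\\ \nabla h(x^*,y^*)&0&0\\ \nabla H(x^*,y^*)&0&0\\ \nabla g_{\mathcal I^*}(x^*,y^*)&0&0\end{bmatrix}$$ (where $\nabla$ is the Jacobian in $(x,y)$, with $u^*,v^*$ fixed) has rank $d+s+m+n-|\mathcal K^*|$, then RCPLD for (CP) holds at $(x^*,y^*,u^*,v^*)$, and $(x^*,y^*,u^*,v^*)$ is an M-stationary point of (CP). Moreover, for any choice of norms on the spaces $\mathbb R^k$ there is $\mu\ge0$ such that $(x^*,y^*,u^*,v^*)$ is a local minimizer (without constraints) of $$(\mathrm{CP}_\mu)\quad F(x,y)+\mu\Big((f(x,y)-V(x))_++\|H(x,y)\|+\|h(x,y)\|+\|G_+(x,y)\|+\|\nabla_yL(x,y,u,v)\|+\sum_{i=1}^m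 d_\Omega(-g_i(x,y),u_i)\Big),$$ where $G_+=\max\{G,0\}$ componentwise and $d_\Omega$ is the distance to $\Omega$. -/

import Mathlib

open Filter Topology

noncomputable section

/-! ### Subdifferentials of real functions on a Euclidean space -/

section Subdifferential

variable {E : Type*} [NormedAddCommGroup E] [InnerProductSpace ℝ E]

/-- Regular (Fréchet) subdifferential:
`φ x' - φ x - ⟪ζ, x' - x⟫ ≥ o(‖x' - x‖)` as `x' → x`. -/
def regularSubdiff (φ : E → ℝ) (x : E) : Set E :=
  {ζ | ∀ ε : ℝ, 0 < ε →
    ∀ᶠ x' in 𝓝 x, -(ε * ‖x' - x‖) ≤ φ x' - φ x - inner ℝ ζ (x' - x)}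

/-- Limiting (Mordukhovich) subdifferential: limits of regular subgradients `ξ k` taken at
points `y k → x` with `φ (y k) → φ x`. -/
def limitingSubdiff (φ : E → ℝ) (x : E) : Set E :=
  {ξ₀ | ∃ (y : ℕ → E) (ξ : ℕ → E),
    Tendsto y atTop (𝓝 x) ∧ Tendsto (fun k => φ (y k)) atTop (𝓝 (φ x)) ∧
    (∀ k, ξ k ∈ regularSubdiff φ (y k)) ∧ Tendsto ξ atTop (𝓝 ξ₀)}

end Subdifferential

/-! ### General feasibility systems with complementarity constraints -/

/-- The functions of a system `g i ≤ 0`, `h j = 0`, `0 ≤ G i ⟂ H i ≥ 0` on `E`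
(no abstract constraint set, that is, the abstract constraint set is all of `E`). -/
structure FeasSystem (E ι κ π : Type*) where
  g : ι → E → ℝ
  h : κ → E → ℝ
  G : π → E → ℝ
  H : π → E → ℝ

namespace FeasSystem

variable {E ι κ π : Type*}

def Feasible (S : FeasSystem E ι κ π) (x : E) : Prop :=
  (∀ i, S.g i x ≤ 0) ∧ (∀ j, S.h j x = 0) ∧
    ∀ i, 0 ≤ S.G i x ∧ 0 ≤ S.H i x ∧ S.G i x * S.H i x = 0

open Classical in
/-- Active inequality constraints. -/
def activeSet [Fintype ι] (S : FeasSystem E ι κ π) (x : E) : Finset ι :=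
  Finset.univ.filter fun i => S.g i x = 0

open Classical in
/-- Indices with `0 = G i x < H i x`. -/
def setI [Fintype π] (S : FeasSystem E ι κ π) (x : E) : Finset π :=
  Finset.univ.filter fun i => S.G i x = 0 ∧ 0 < S.H i x

open Classical in
/-- Indices with `0 = G i x = H i x`. -/
def setJ [Fintype π] (S : FeasSystem E ι κ π) (x : E) : Finset π :=
  Finset.univ.filter fun i => S.G i x = 0 ∧ S.H i x = 0

open Classical in
/-- Indices with `G i x > H i x = 0`. -/
def setK [Fintype π] (S : FeasSystem E ι κ π) (x : E) : Finset π :=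
  Finset.univ.filter fun i => 0 < S.G i x ∧ S.H i x = 0

variable [NormedAddCommGroup E] [InnerProductSpace ℝ E] [CompleteSpace E]

/-- The family of gradients at `x` of `h` over `A`, of `G` over `B` and of `H` over `D`. -/
def gradFamily (S : FeasSystem E ι κ π) (A : Finset κ) (B D : Finset π) (x : E) :
    {j // j ∈ A} ⊕ {i // i ∈ B} ⊕ {i // i ∈ D} → E
  | Sum.inl j => gradient (S.h j) x
  | Sum.inr (Sum.inl i) => gradient (S.G i) x
  | Sum.inr (Sum.inr i) => gradient (S.H i) x

open Classical in
/-- Relaxed constant positive linear dependence constraint qualification at `x₀`.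
Without abstract constraint set the normal cone is `{0}`, so that no normal vectors occur.
Linear (in)dependence, bases and ranks are those of indexed families of vectors, and the
multiplier vector is nonzero in the components that occur in the linear combination. -/
def RCPLD [Fintype ι] [Fintype κ] [Fintype π] (S : FeasSystem E ι κ π) (x₀ : E) : Prop :=
  S.Feasible x₀ ∧
  (∃ r : ℕ, ∀ᶠ x in 𝓝 x₀,
    Module.finrank ℝ (Submodule.span ℝ
      (Set.range (S.gradFamily Finset.univ (S.setI x₀) (S.setK x₀) x))) = r) ∧
  ∀ (I₁ : Finset κ) (I₂ I₃ : Finset π), I₂ ⊆ S.setI x₀ → I₃ ⊆ S.setK x₀ →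
    LinearIndependent ℝ (S.gradFamily I₁ I₂ I₃ x₀) →
    Submodule.span ℝ (Set.range (S.gradFamily I₁ I₂ I₃ x₀)) =
      Submodule.span ℝ
        (Set.range (S.gradFamily Finset.univ (S.setI x₀) (S.setK x₀) x₀)) →
    ∀ (I₄ : Finset ι) (I₅ I₆ : Finset π),
      I₄ ⊆ S.activeSet x₀ → I₅ ⊆ S.setJ x₀ → I₆ ⊆ S.setJ x₀ →
      ∀ (lg : ι → ℝ) (lh : κ → ℝ) (lG lH : π → ℝ) (v₀ : ι → E),
        ((∃ i ∈ I₄, lg i ≠ 0) ∨ (∃ j ∈ I₁, lh j ≠ 0) ∨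
          (∃ i ∈ I₂ ∪ I₅, lG i ≠ 0) ∨ (∃ i ∈ I₃ ∪ I₆, lH i ≠ 0)) →
        (∀ i ∈ I₄, 0 ≤ lg i) →
        (∀ i ∈ S.setJ x₀, (0 < lG i ∧ 0 < lH i) ∨ lG i * lH i = 0) →
        (∀ i ∈ I₄, v₀ i ∈ limitingSubdiff (S.g i) x₀) →
        (0 : E) = ∑ i ∈ I₄, lg i • v₀ i + ∑ j ∈ I₁, lh j • gradient (S.h j) x₀
          - ∑ i ∈ I₂ ∪ I₅, lG i • gradient (S.G i) x₀
          - ∑ i ∈ I₃ ∪ I₆, lH i • gradient (S.H i) x₀ →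
        ∀ (x : ℕ → E) (v : ℕ → ι → E),
          (∀ k, x k ≠ x₀) → Tendsto x atTop (𝓝 x₀) →
          (∀ k, ∀ i ∈ I₄, v k i ∈ limitingSubdiff (S.g i) (x k)) →
          (∀ i ∈ I₄, Tendsto (fun k => v k i) atTop (𝓝 (v₀ i))) →
          ∀ᶠ k in atTop, ¬ LinearIndependent ℝ
            (Sum.elim (fun i : {i // i ∈ I₄} => v k i)
              (S.gradFamily I₁ (I₂ ∪ I₅) (I₃ ∪ I₆) (x k)))

open Classical in
/-- `x₀` is an M-stationary point of `min φ` over the feasible points of `S`: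
`0 ∈ ∂φ + ∑ lg i ∂g i + ∑ lh j ∇h j - ∑ lG i ∇G i - ∑ lH i ∇H i` at `x₀`. -/
def MStationary [Fintype ι] [Fintype κ] [Fintype π] (S : FeasSystem E ι κ π)
    (φ : E → ℝ) (x₀ : E) : Prop :=
  S.Feasible x₀ ∧
  ∃ (lg : ι → ℝ) (lh : κ → ℝ) (lG lH : π → ℝ) (ξ : E) (v : ι → E),
    (∀ i ∈ S.activeSet x₀, 0 ≤ lg i) ∧
    ξ ∈ limitingSubdiff φ x₀ ∧
    (∀ i ∈ S.activeSet x₀, v i ∈ limitingSubdiff (S.g i) x₀) ∧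
    (0 : E) = ξ + ∑ i ∈ S.activeSet x₀, lg i • v i + ∑ j, lh j • gradient (S.h j) x₀
      - ∑ i ∈ S.setI x₀ ∪ S.setJ x₀, lG i • gradient (S.G i) x₀
      - ∑ i ∈ S.setK x₀ ∪ S.setJ x₀, lH i • gradient (S.H i) x₀ ∧
    (∀ i ∈ S.setI x₀, lH i = 0) ∧ (∀ i ∈ S.setK x₀, lG i = 0) ∧
    ∀ i ∈ S.setJ x₀, (0 < lG i ∧ 0 < lH i) ∨ lG i * lH i = 0

end FeasSystem

/-! ### Bilevel programs and the combined program -/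

/-- `ℝᵏ` with its Euclidean structure. -/
abbrev Euc (k : ℕ) := EuclideanSpace ℝ (Fin k)

/-- The space `ℝᵈ × ℝˢ × ℝᵐ × ℝⁿ` of the variables `(x, y, u, v)`, with its Euclidean
structure. -/
abbrev CPSpace (d s m n : ℕ) := EuclideanSpace ℝ (Fin d ⊕ Fin s ⊕ Fin m ⊕ Fin n)

namespace CPSpace

variable {d s m n : ℕ}

def x (z : CPSpace d s m n) : Euc d := WithLp.toLp 2 fun i => z (Sum.inl i)

def y (z : CPSpace d s m n) : Euc s := WithLp.toLp 2 fun i => z (Sum.inr (Sum.inl i))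

def u (z : CPSpace d s m n) : Euc m :=
  WithLp.toLp 2 fun i => z (Sum.inr (Sum.inr (Sum.inl i)))

def v (z : CPSpace d s m n) : Euc n :=
  WithLp.toLp 2 fun i => z (Sum.inr (Sum.inr (Sum.inr i)))

/-- The pair `(x, y)`. -/
def xy (z : CPSpace d s m n) : Euc d × Euc s := (CPSpace.x z, CPSpace.y z)

end CPSpace

/-- Gradient in the second variable, `∇_y φ (x, y)`. -/
def gradY {d s : ℕ} (φ : Euc d × Euc s → ℝ) (w : Euc d × Euc s) : Euc s :=
  gradient (fun y => φ (w.1, y)) w.2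

/-- Partial derivative of `φ (x, y)` with respect to one of the `d + s` coordinates of
`(x, y)`. -/
def partialXY {d s : ℕ} (φ : Euc d × Euc s → ℝ) (w : Euc d × Euc s) :
    Fin d ⊕ Fin s → ℝ
  | Sum.inl i => fderiv ℝ φ w (EuclideanSpace.single i 1, 0)
  | Sum.inr k => fderiv ℝ φ w (0, EuclideanSpace.single k 1)

/-- The functions of a bilevel program: upper level objective `F` and constraints `G ≤ 0`,
`H = 0`; lower level objective `f` and constraints `g ≤ 0`, `h = 0`. -/
structure Bilevel (d s p q m n : ℕ) where
  F : Euc d × Euc s → ℝ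
  G : Fin p → Euc d × Euc s → ℝ
  H : Fin q → Euc d × Euc s → ℝ
  f : Euc d × Euc s → ℝ
  g : Fin m → Euc d × Euc s → ℝ
  h : Fin n → Euc d × Euc s → ℝ

/-- An extended real function is finite and Lipschitz continuous on a neighbourhood
of `x₀`. -/
def LipschitzNear {d : ℕ} (V : Euc d → EReal) (x₀ : Euc d) : Prop :=
  ∃ U ∈ 𝓝 x₀, (∀ x ∈ U, V x ≠ ⊥ ∧ V x ≠ ⊤) ∧
    ∃ K : NNReal, LipschitzOnWith K (fun x => (V x).toReal) U

/-- The complementarity set `{(a, b) | 0 ≤ a ⟂ b ≥ 0}` in the plane. -/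
def complSet : Set (Euc 2) := {w | 0 ≤ w 0 ∧ 0 ≤ w 1 ∧ w 0 * w 1 = 0}

/-- Distance from `(a, b)` to the complementarity set, in the norm `N`. -/
def distCompl (N : Seminorm ℝ (Euc 2)) (a b : ℝ) : ℝ :=
  ⨅ w : complSet, N (!₂[a, b] - (w : Euc 2))

namespace Bilevel

variable {d s p q m n : ℕ}

/-- Feasible set `Y(x)` of the lower level program. -/
def lowerFeasible (P : Bilevel d s p q m n) (x : Euc d) : Set (Euc s) :=
  {y | (∀ i, P.g i (x, y) ≤ 0) ∧ ∀ j, P.h j (x, y) = 0}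

/-- Value function `V(x) = inf {f(x, y) | y ∈ Y(x)}` of the lower level program, with values
in the extended reals. -/
def value (P : Bilevel d s p q m n) (x : Euc d) : EReal :=
  ⨅ y ∈ P.lowerFeasible x, ((P.f (x, y) : ℝ) : EReal)

/-- `∇_y L = ∇_y f + ∑ u i ∇_y g i + ∑ v j ∇_y h j` at `w = (x, y)`. -/
def gradYL (P : Bilevel d s p q m n) (w : Euc d × Euc s) (u : Euc m) (v : Euc n) : Euc s :=
  gradY P.f w + ∑ i, u i • gradY (P.g i) w + ∑ j, v j • gradY (P.h j) w

/-- Feasible set of the combined program. -/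
def cpFeasible (P : Bilevel d s p q m n) : Set (CPSpace d s m n) :=
  {z | ((P.f z.xy : ℝ) : EReal) ≤ P.value z.x ∧
    (∀ i, P.G i z.xy ≤ 0) ∧ (∀ j, P.H j z.xy = 0) ∧ (∀ j, P.h j z.xy = 0) ∧
    P.gradYL z.xy z.u z.v = 0 ∧
    ∀ i, 0 ≤ -P.g i z.xy ∧ 0 ≤ z.u i ∧ -P.g i z.xy * z.u i = 0}

/-- Local optimal solutions of the combined program. -/
def IsLocalSolutionCP (P : Bilevel d s p q m n) (z₀ : CPSpace d s m n) : Prop :=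
  z₀ ∈ P.cpFeasible ∧ IsLocalMinOn (fun z : CPSpace d s m n => P.F z.xy) P.cpFeasible z₀

/-- The constraints of the combined program as a feasibility system. Where the value function
is finite, its feasible points are those of the combined program. -/
def cpSystem (P : Bilevel d s p q m n) :
    FeasSystem (CPSpace d s m n) (Unit ⊕ Fin p) (Fin q ⊕ Fin n ⊕ Fin s) (Fin m) where
  g := Sum.elim (fun _ z => P.f z.xy - (P.value z.x).toReal) (fun i z => P.G i z.xy)
  h := Sum.elim (fun j z => P.H j z.xy)
    (Sum.elim (fun j z => P.h j z.xy) (fun k z => P.gradYL z.xy z.u z.v k))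
  G := fun i z => -P.g i z.xy
  H := fun i z => z.u i

open Classical in
/-- Indices with `g i = 0` and `u i > 0`. -/
def idxI (P : Bilevel d s p q m n) (z : CPSpace d s m n) : Finset (Fin m) :=
  Finset.univ.filter fun i => P.g i z.xy = 0 ∧ 0 < z.u i

open Classical in
/-- Indices with `g i = 0` and `u i = 0`. -/
def idxJ (P : Bilevel d s p q m n) (z : CPSpace d s m n) : Finset (Fin m) :=
  Finset.univ.filter fun i => P.g i z.xy = 0 ∧ z.u i = 0

open Classical in
/-- Indices with `g i < 0` and `u i = 0`. -/
def idxK (P : Bilevel d s p q m n) (z : CPSpace d s m n) : Finset (Fin m) :=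
  Finset.univ.filter fun i => P.g i z.xy < 0 ∧ z.u i = 0

/-- The matrix with the block rows
`[∇(∇_y f + u ∇_y g + v ∇_y h), (∇_y h)ᵀ, (∇_y g_{I ∪ J})ᵀ]`,
`[∇h, 0, 0]`, `[∇H, 0, 0]` and `[∇g_I, 0, 0]`; here `∇` is the Jacobian with respect to
`(x, y)`, the multipliers `(u, v)` being held fixed. -/
def matJ (P : Bilevel d s p q m n) (z : CPSpace d s m n) :
    Matrix (Fin s ⊕ Fin n ⊕ Fin q ⊕ {i // i ∈ P.idxI z})
      ((Fin d ⊕ Fin s) ⊕ Fin n ⊕ {i // i ∈ P.idxI z ∪ P.idxJ z}) ℝ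
  | Sum.inl k, Sum.inl c => partialXY (fun w => P.gradYL w z.u z.v k) z.xy c
  | Sum.inl k, Sum.inr (Sum.inl j) => gradY (P.h j) z.xy k
  | Sum.inl k, Sum.inr (Sum.inr i) => gradY (P.g i) z.xy k
  | Sum.inr (Sum.inl j), Sum.inl c => partialXY (P.h j) z.xy c
  | Sum.inr (Sum.inr (Sum.inl j)), Sum.inl c => partialXY (P.H j) z.xy c
  | Sum.inr (Sum.inr (Sum.inr i)), Sum.inl c => partialXY (P.g i) z.xy c
  | Sum.inr _, Sum.inr _ => 0

/-- The penalty function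
`(f - V)₊ + ‖H‖ + ‖h‖ + ‖G₊‖ + ‖∇_y L‖ + ∑ i, dist ((-g i, u i), complementarity set)`,
where `N k` is the norm used on `ℝᵏ`. -/
def penalty (P : Bilevel d s p q m n) (N : ∀ k, Seminorm ℝ (Euc k))
    (z : CPSpace d s m n) : ℝ :=
  max (P.f z.xy - (P.value z.x).toReal) 0
    + N q (WithLp.toLp 2 fun j => P.H j z.xy)
    + N n (WithLp.toLp 2 fun j => P.h j z.xy)
    + N p (WithLp.toLp 2 fun i => max (P.G i z.xy) 0)
    + N s (P.gradYL z.xy z.u z.v)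
    + ∑ i, distCompl (N 2) (-P.g i z.xy) (z.u i)

end Bilevel

end

/-! The rank hypothesis says that $J^*$ has full column rank: every index lies in exactly one of
$\mathcal I^*,\mathcal J^*,\mathcal K^*$, so $d+s+m+n-|\mathcal K^*|$ is the number of columns. A
direction annihilated by the derivatives of $H$, $h$, $\nabla_yL$, $g_{\mathcal I^*}$ and
$u_{\mathcal K^*}$ has no $u_{\mathcal K^*}$-part, and its remaining coordinates form a kernel
vector of $J^*$; so it is zero (`eq_zero_of_fderiv_eq_zero`). Equivalently, the gradients of these
equality-type constraints span the whole space, and all three conclusions follow.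

RCPLD: the rank is locally constant because spanning is an open condition. A basis among these
gradients already has as many members as the dimension, so any enlarged family is dependent, while
without enlargement a nontrivial relation contradicts independence (`rcpld_of_span_eq_top`).

M-stationarity: any limiting subgradient of the objective is a combination of these gradients, so
all other multipliers can be zero (`mStationary_of_span_eq_top`). Subgradients exist by Lipschitz
continuity.

Exact penalty: an injective derivative bounds $\|z-z^*\|$ by the constraint residuals
(`exists_norm_sub_le_sum_abs`), hence by the penalty (`eventually_abs_funFamily_le_penalty`). In
particular the feasible point is isolated, and the Lipschitz objective decreases by at most a
multiple of the penalty. -/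

noncomputable section

/-! ### Existence of limiting subgradients -/

section Subdifferential

variable {E : Type*} [NormedAddCommGroup E] [InnerProductSpace ℝ E]

/-- Take `x` minimizing `φ + c‖· - x₀‖²` on the ball. Comparison with `x₀` bounds its distance by `K
/ c < r`, so `x` is interior, and minus the gradient of the quadratic is a regular subgradient: the
error `c‖x' - x‖²` is at most `ε‖x' - x‖` within radius `ε / c`. -/
theorem exists_mem_regularSubdiff_of_lipschitzOnWith [ProperSpace E] {φ : E → ℝ} {x₀ : E}
    {K : NNReal} {r c : ℝ} (hr : 0 < r) (hφ : LipschitzOnWith K φ (Metric.closedBall x₀ r))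
    (hc : K < c * r) :
    ∃ x, c * ‖x - x₀‖ ≤ K ∧ ‖x - x₀‖ < r ∧ -(2 * c) • (x - x₀) ∈ regularSubdiff φ x := by
  have hc0 : 0 < c := pos_of_mul_pos_left (lt_of_le_of_lt K.2 hc) hr.le
  have hcont : ContinuousOn (fun x => φ x + c * ‖x - x₀‖ ^ 2) (Metric.closedBall x₀ r) :=
    hφ.continuousOn.add (by fun_prop)
  obtain ⟨x, hx, hmin⟩ := (isCompact_closedBall x₀ r).exists_isMinOn
    ⟨x₀, Metric.mem_closedBall_self hr.le⟩ hcont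
  have h0 : φ x + c * ‖x - x₀‖ ^ 2 ≤ φ x₀ := by
    simpa using hmin (Metric.mem_closedBall_self hr.le)
  have hlip : φ x₀ - φ x ≤ K * ‖x - x₀‖ := by
    have := hφ.dist_le_mul x hx x₀ (Metric.mem_closedBall_self hr.le)
    rw [Real.dist_eq, dist_eq_norm] at this
    linarith [neg_abs_le (φ x - φ x₀)]
  have h1 : c * ‖x - x₀‖ ≤ K := by
    rcases (norm_nonneg (x - x₀)).eq_or_lt with h | h
    · rw [← h]; simp
    · exact le_of_mul_le_mul_right (by nlinarith) h
  have h2 : ‖x - x₀‖ < r := lt_of_mul_lt_mul_left (h1.trans_lt hc) hc0.le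
  refine ⟨x, h1, h2, fun ε hε => ?_⟩
  have hball : Metric.ball x₀ r ∈ 𝓝 x :=
    Metric.isOpen_ball.mem_nhds (by simpa [dist_eq_norm] using h2)
  filter_upwards [hball, Metric.ball_mem_nhds x (div_pos hε hc0)] with x' hx' hx''
  have h3 : φ x + c * ‖x - x₀‖ ^ 2 ≤ φ x' + c * ‖x' - x₀‖ ^ 2 :=
    hmin (Metric.ball_subset_closedBall hx')
  have h4 : ‖x' - x₀‖ ^ 2
      = ‖x - x₀‖ ^ 2 + 2 * inner ℝ (x - x₀) (x' - x) + ‖x' - x‖ ^ 2 := by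
    rw [← norm_add_sq_real]; congr 2; abel
  have h5 : c * ‖x' - x‖ ≤ ε := by
    rw [Metric.mem_ball, dist_eq_norm, lt_div_iff₀ hc0] at hx''
    linarith
  have h6 : c * ‖x' - x‖ ^ 2 ≤ ε * ‖x' - x‖ := by
    nlinarith [norm_nonneg (x' - x)]
  rw [h4] at h3
  rw [inner_smul_left, conj_trivial]
  linarith

/-- A function that is Lipschitz continuous near a point has a limiting subgradient there. -/
theorem limitingSubdiff_nonempty [ProperSpace E] {φ : E → ℝ} {x₀ : E} {K : NNReal} {U : Set E}
    (hU : U ∈ 𝓝 x₀) (hφ : LipschitzOnWith K φ U) : (limitingSubdiff φ x₀).Nonempty := by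
  obtain ⟨r, hr, hrU⟩ := Metric.nhds_basis_closedBall.mem_iff.1 hU
  -- The weights `k + K / r + 1` exceed `K / r` and tend to infinity: the minimizers converge to
  -- `x₀` while their subgradients stay within norm `2 * K`, so a subsequence of the subgradients
  -- converges.
  have hc : ∀ k : ℕ, (K : ℝ) < (k + (K / r + 1)) * r := fun k => by
    have : (K / r : ℝ) * r = K := by field_simp
    nlinarith [mul_nonneg (Nat.cast_nonneg (α := ℝ) k) hr.le]
  choose y hy1 hy2 hy3 using fun k : ℕ =>
    exists_mem_regularSubdiff_of_lipschitzOnWith hr (hφ.mono hrU) (hc k)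
  have hpos : ∀ k : ℕ, (0 : ℝ) < k + (K / r + 1) := fun k => by positivity
  have hy : Tendsto y atTop (𝓝 x₀) := by
    rw [tendsto_iff_norm_sub_tendsto_zero]
    refine squeeze_zero (g := fun k : ℕ => (K : ℝ) / (k + (K / r + 1)))
      (fun _ => norm_nonneg _) (fun k => ?_) ?_
    · rw [le_div_iff₀ (hpos k), mul_comm]
      exact hy1 k
    · exact tendsto_const_nhds.div_atTop
        (tendsto_atTop_add_const_right _ _ tendsto_natCast_atTop_atTop)
  have hbdd : ∀ k : ℕ, -(2 * (k + (K / r + 1) : ℝ)) • (y k - x₀)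
      ∈ Metric.closedBall (0 : E) (2 * K) := fun k : ℕ => by
    rw [mem_closedBall_zero_iff, norm_smul, norm_neg, Real.norm_eq_abs,
      abs_of_pos (by linarith [hpos k])]
    linarith [hy1 k]
  obtain ⟨ξ, -, τ, hτ, hlim⟩ := (isCompact_closedBall (0 : E) (2 * K)).tendsto_subseq hbdd
  have hyτ := hy.comp hτ.tendsto_atTop
  exact ⟨ξ, y ∘ τ, _, hyτ, ((hφ.continuousOn.continuousAt hU).tendsto.comp hyτ),
    fun k => hy3 (τ k), hlim⟩

end Subdifferential

/-! ### Consequences of an injective derivative -/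

section ErrorBound

variable {E : Type*} [NormedAddCommGroup E] [InnerProductSpace ℝ E] [FiniteDimensional ℝ E]

/-- In finite dimension an injective derivative is bounded below, and near `x₀` the linearization
error is too small to spoil this. -/
theorem exists_norm_sub_le_sum_abs {α : Type*} [Fintype α] {ψ : α → E → ℝ} {x₀ : E}
    (hψ : ∀ a, DifferentiableAt ℝ (ψ a) x₀) (h0 : ∀ a, ψ a x₀ = 0)
    (hinj : ∀ w, (∀ a, fderiv ℝ (ψ a) x₀ w = 0) → w = 0) :
    ∃ C : ℝ, 0 ≤ C ∧ ∀ᶠ x in 𝓝 x₀, ‖x - x₀‖ ≤ C * ∑ a, |ψ a x| := by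
  have hd : HasFDerivAt (fun x a => ψ a x)
      (ContinuousLinearMap.pi fun a => fderiv ℝ (ψ a) x₀) x₀ :=
    hasFDerivAt_pi.2 fun a => (hψ a).hasFDerivAt
  set f' := ContinuousLinearMap.pi fun a => fderiv ℝ (ψ a) x₀
  obtain ⟨K, hK0, hK⟩ := LinearMap.exists_antilipschitzWith (f' : E →L[ℝ] α → ℝ).toLinearMap
    (LinearMap.ker_eq_bot'.2 fun w hw => hinj w fun a => congrFun hw a)
  have hK0' : (0 : ℝ) < K := hK0
  refine ⟨2 * K, by positivity, ?_⟩
  -- With error at most `(2K)⁻¹‖x - x₀‖`, multiplication by `K` leaves half of `‖x - x₀‖`, which is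
  -- absorbed on the left.
  filter_upwards [hd.isLittleO.bound (inv_pos.2 (mul_pos two_pos hK0'))] with x hx
  have h1 : ‖x - x₀‖ ≤ K * ‖f' (x - x₀)‖ := hK.le_mul_norm (map_zero _) (x - x₀)
  have h2 : ‖f' (x - x₀)‖ ≤ ‖fun a => ψ a x‖ + (2 * K : ℝ)⁻¹ * ‖x - x₀‖ := by
    have : f' (x - x₀) = (fun a => ψ a x)
        - ((fun a => ψ a x) - (fun a => ψ a x₀) - f' (x - x₀)) := by
      ext a; simp [h0]
    rw [this]
    exact (norm_sub_le _ _).trans (by gcongr)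
  have h3 : (K : ℝ) * ((2 * K : ℝ)⁻¹ * ‖x - x₀‖) = ‖x - x₀‖ / 2 := by field_simp
  have h4 : ‖x - x₀‖ ≤ 2 * K * ‖fun a => ψ a x‖ := by
    nlinarith [mul_le_mul_of_nonneg_left h2 hK0'.le]
  refine h4.trans (mul_le_mul_of_nonneg_left ?_ (by positivity))
  refine (pi_norm_le_iff_of_nonneg (Finset.sum_nonneg fun _ _ => abs_nonneg _)).2 fun a => ?_
  simpa [h0] using Finset.single_le_sum (f := fun a => |ψ a x|) (fun _ _ => abs_nonneg _)
    (Finset.mem_univ a)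

/-- A vector orthogonal to every gradient is killed by every derivative, so the orthogonal
complement of the span is trivial. -/
theorem span_range_gradient_eq_top {α : Type*} {ψ : α → E → ℝ} {x₀ : E}
    (hinj : ∀ w, (∀ a, fderiv ℝ (ψ a) x₀ w = 0) → w = 0) :
    Submodule.span ℝ (Set.range fun a => gradient (ψ a) x₀) = ⊤ := by
  rw [← Submodule.orthogonal_eq_bot_iff, Submodule.eq_bot_iff]
  intro w hw
  refine hinj w fun a => ?_
  rw [← hw (gradient (ψ a) x₀) (Submodule.subset_span ⟨a, rfl⟩), gradient,
    InnerProductSpace.toDual_symm_apply]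

end ErrorBound

/-- Extract a basis from the family at `x₀`. Linear independence of finitely many vectors is an open
condition, and by cardinality the same indices still give a basis nearby. -/
theorem eventually_span_range_eq_top {E α X : Type*} [NormedAddCommGroup E] [NormedSpace ℝ E]
    [FiniteDimensional ℝ E] [Finite α] [TopologicalSpace X] {e : X → α → E} {x₀ : X}
    (he : ∀ a, ContinuousAt (fun x => e x a) x₀)
    (hspan : Submodule.span ℝ (Set.range (e x₀)) = ⊤) :
    ∀ᶠ x in 𝓝 x₀, Submodule.span ℝ (Set.range (e x)) = ⊤ := by
  obtain ⟨β, b, -, hb, hli⟩ := exists_linearIndependent' ℝ (e x₀)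
  have := hli.finite
  have := Fintype.ofFinite β
  have hcont : ContinuousAt (fun x => e x ∘ b) x₀ :=
    continuousAt_pi.2 fun i => he (b i)
  filter_upwards [hcont.eventually_mem (isOpen_setOfPred_linearIndependent.mem_nhds hli)] with x hx
  have hcard : Fintype.card β = Module.finrank ℝ E := by
    rw [← finrank_span_eq_card hli, hb, hspan, finrank_top]
  have htop := LinearIndependent.span_eq_top_of_card_eq_finrank' (K := ℝ) hx hcard
  exact top_unique (htop ▸ Submodule.span_mono (Set.range_comp_subset_range _ _))

/-! ### RCPLD and M-stationarity from spanning gradients -/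

namespace FeasSystem

variable {E ι κ π : Type*}

/-- The functions of `S` whose gradients form `gradFamily`. -/
def funFamily (S : FeasSystem E ι κ π) (A : Finset κ) (B D : Finset π) :
    {j // j ∈ A} ⊕ {i // i ∈ B} ⊕ {i // i ∈ D} → E → ℝ
  | Sum.inl j => S.h j
  | Sum.inr (Sum.inl i) => S.G i
  | Sum.inr (Sum.inr i) => S.H i

theorem disjoint_setI_setJ [Fintype π] (S : FeasSystem E ι κ π) (x : E) : Disjoint (S.setI x) (S.setJ x) := by
  simp only [Finset.disjoint_left, setI, setJ, Finset.mem_filter]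
  rintro i ⟨-, -, h⟩ ⟨-, -, h'⟩
  exact h.ne' h'

theorem disjoint_setK_setJ [Fintype π] (S : FeasSystem E ι κ π) (x : E) : Disjoint (S.setK x) (S.setJ x) := by
  simp only [Finset.disjoint_left, setK, setJ, Finset.mem_filter]
  rintro i ⟨-, h, -⟩ ⟨-, h', -⟩
  exact h.ne' h'

variable [NormedAddCommGroup E] [InnerProductSpace ℝ E]

theorem gradFamily_eq_gradient [CompleteSpace E] (S : FeasSystem E ι κ π) (A : Finset κ)
    (B D : Finset π) (x : E) :
    S.gradFamily A B D x = fun a => gradient (S.funFamily A B D a) x := by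
  ext (j | i | i) <;> rfl

variable [FiniteDimensional ℝ E] [Fintype ι] [Fintype κ] [Fintype π]

/-- If the gradients of the equality constraints span the whole space, RCPLD holds. -/
theorem rcpld_of_span_eq_top {S : FeasSystem E ι κ π} {x₀ : E} (hfeas : S.Feasible x₀)
    (hcont : ∀ a, ContinuousAt
      (fun x => S.gradFamily Finset.univ (S.setI x₀) (S.setK x₀) x a) x₀)
    (hspan : Submodule.span ℝ
      (Set.range (S.gradFamily Finset.univ (S.setI x₀) (S.setK x₀) x₀)) = ⊤) :
    S.RCPLD x₀ := by
  classical
  refine ⟨hfeas, ⟨Module.finrank ℝ E, ?_⟩, ?_⟩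
  · filter_upwards [eventually_span_range_eq_top hcont hspan] with x hx
    rw [hx, finrank_top]
  intro I₁ I₂ I₃ hI₂ hI₃ hli htop I₄ I₅ I₆ hI₄ hI₅ hI₆ lg lh lG lH v₀ hne _ _ _ hsum x v _ _ _ _
  -- Independence at `x k` would allow at most `finrank` vectors, and `I₁`, `I₂`, `I₃` already
  -- supply that many. Hence `I₄`, `I₅`, `I₆` are empty, and the given relation is a nontrivial one
  -- among basis vectors.
  refine Eventually.of_forall fun k hk => ?_
  have hcard := finrank_span_eq_card hli
  rw [htop, hspan, finrank_top] at hcard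
  have hle := hk.fintype_card_le_finrank
  have h25 : Disjoint I₂ I₅ := (S.disjoint_setI_setJ x₀).mono hI₂ hI₅
  have h36 : Disjoint I₃ I₆ := (S.disjoint_setK_setJ x₀).mono hI₃ hI₆
  simp only [Fintype.card_sum, Fintype.card_coe, Finset.card_union_of_disjoint h25,
    Finset.card_union_of_disjoint h36] at hle hcard
  obtain rfl : I₄ = ∅ := Finset.card_eq_zero.1 (by omega)
  obtain rfl : I₅ = ∅ := Finset.card_eq_zero.1 (by omega)
  obtain rfl : I₆ = ∅ := Finset.card_eq_zero.1 (by omega)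
  simp only [Finset.union_empty, Finset.sum_empty, zero_add] at hne hsum
  have hzero := Fintype.linearIndependent_iff.1 hli
    (Sum.elim (fun j => lh j) (Sum.elim (fun i => -lG i) fun i => -lH i)) (by
      simp only [Fintype.sum_sum_type, Sum.elim_inl, Sum.elim_inr, gradFamily, neg_smul,
        Finset.sum_neg_distrib]
      rw [Finset.sum_coe_sort I₁ fun j => lh j • gradient (S.h j) x₀,
        Finset.sum_coe_sort I₂ fun i => lG i • gradient (S.G i) x₀,
        Finset.sum_coe_sort I₃ fun i => lH i • gradient (S.H i) x₀, hsum]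
      abel)
  rcases hne with ⟨i, hi, -⟩ | ⟨j, hj, h⟩ | ⟨i, hi, h⟩ | ⟨i, hi, h⟩
  · simp at hi
  · exact h (hzero (Sum.inl ⟨j, hj⟩))
  · exact h (neg_eq_zero.1 (hzero (Sum.inr (Sum.inl ⟨i, hi⟩))))
  · exact h (neg_eq_zero.1 (hzero (Sum.inr (Sum.inr ⟨i, hi⟩))))

/-- The coefficients of a subgradient `ξ` in the spanning family are, up to sign, the multipliers.
The active inequalities get multiplier zero, but the definition still asks for a subgradient of
each, whence `hg`. -/
theorem mStationary_of_span_eq_top {S : FeasSystem E ι κ π} {x₀ : E} {φ : E → ℝ}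
    (hfeas : S.Feasible x₀) (hφ : (limitingSubdiff φ x₀).Nonempty)
    (hg : ∀ i ∈ S.activeSet x₀, (limitingSubdiff (S.g i) x₀).Nonempty)
    (hspan : Submodule.span ℝ
      (Set.range (S.gradFamily Finset.univ (S.setI x₀) (S.setK x₀) x₀)) = ⊤) :
    S.MStationary φ x₀ := by
  classical
  obtain ⟨ξ, hξ⟩ := hφ
  choose! v hv using hg
  obtain ⟨c, hc⟩ := (Submodule.mem_span_range_iff_exists_fun ℝ).1
    (hspan ▸ Submodule.mem_top : ξ ∈ Submodule.span ℝ
      (Set.range (S.gradFamily Finset.univ (S.setI x₀) (S.setK x₀) x₀)))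
  -- Extension by zero makes both multipliers vanish on `S.setJ x₀`, so the sign alternative there
  -- holds trivially.
  let lG : π → ℝ := fun i => if hi : i ∈ S.setI x₀ then c (Sum.inr (Sum.inl ⟨i, hi⟩)) else 0
  let lH : π → ℝ := fun i => if hi : i ∈ S.setK x₀ then c (Sum.inr (Sum.inr ⟨i, hi⟩)) else 0
  have hG0 : ∀ i, i ∉ S.setI x₀ → lG i = 0 := fun i hi => dif_neg hi
  have hH0 : ∀ i, i ∉ S.setK x₀ → lH i = 0 := fun i hi => dif_neg hi
  refine ⟨hfeas, 0, fun j => -c (Sum.inl ⟨j, Finset.mem_univ j⟩), lG, lH, ξ, v, by simp, hξ, hv,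
    ?_, fun i hi => hH0 i fun hi' => ?_, fun i hi => hG0 i fun hi' => ?_, fun i hi => Or.inr ?_⟩
  · have hGs : ∑ i ∈ S.setI x₀ ∪ S.setJ x₀, lG i • gradient (S.G i) x₀
        = ∑ i : {i // i ∈ S.setI x₀}, c (Sum.inr (Sum.inl i)) • gradient (S.G i) x₀ := by
      rw [← Finset.sum_subset Finset.subset_union_left
        fun i _ hi => by rw [hG0 i hi, zero_smul],
        ← Finset.sum_coe_sort (S.setI x₀) fun i => lG i • gradient (S.G i) x₀]
      exact Finset.sum_congr rfl fun i _ => by simp [lG]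
    have hHs : ∑ i ∈ S.setK x₀ ∪ S.setJ x₀, lH i • gradient (S.H i) x₀
        = ∑ i : {i // i ∈ S.setK x₀}, c (Sum.inr (Sum.inr i)) • gradient (S.H i) x₀ := by
      rw [← Finset.sum_subset Finset.subset_union_left
        fun i _ hi => by rw [hH0 i hi, zero_smul],
        ← Finset.sum_coe_sort (S.setK x₀) fun i => lH i • gradient (S.H i) x₀]
      exact Finset.sum_congr rfl fun i _ => by simp [lH]
    have hhs : ∑ j, c (Sum.inl ⟨j, Finset.mem_univ j⟩) • gradient (S.h j) x₀
        = ∑ j : {j // j ∈ (Finset.univ : Finset κ)}, c (Sum.inl j) • gradient (S.h j) x₀ := by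
      rw [← Finset.sum_attach]; rfl
    simp only [Fintype.sum_sum_type, gradFamily] at hc
    simp only [neg_smul, Finset.sum_neg_distrib, hGs, hHs, hhs, Pi.zero_apply, zero_smul,
      Finset.sum_const_zero]
    rw [← hc]
    abel
  · simp only [setI, setK, Finset.mem_filter] at hi hi'
    exact hi'.2.1.ne' hi.2.1
  · simp only [setI, setK, Finset.mem_filter] at hi hi'
    exact hi.2.1.ne' hi'.2.1
  · rw [hG0 i fun h => Finset.disjoint_left.1 (S.disjoint_setI_setJ x₀) h hi, zero_mul]

end FeasSystem

/-! ### Norms and the distance to the complementarity set -/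

/-- All norms on `ℝᵏ` dominate a multiple of the Euclidean norm. -/
theorem Seminorm.exists_norm_le_mul {k : ℕ} (N : Seminorm ℝ (Euc k))
    (hN : ∀ w, N w = 0 → w = 0) : ∃ C : ℝ, 0 ≤ C ∧ ∀ w, ‖w‖ ≤ C * N w := by
  have hcont : Continuous N := 
    continuousOn_univ.1 (N.convexOn.continuousOn isOpen_univ)
  -- The unit sphere is empty only for `k = 0`, where every vector is zero.
  rcases (Metric.sphere (0 : Euc k) 1).eq_empty_or_nonempty with h | h
  · refine ⟨0, le_rfl, fun w => ?_⟩
    by_contra! hw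
    rw [zero_mul] at hw
    refine Set.eq_empty_iff_forall_notMem.1 h (‖w‖⁻¹ • w) ?_
    rw [mem_sphere_zero_iff_norm, norm_smul, norm_inv, norm_norm, inv_mul_cancel₀ hw.ne']
  obtain ⟨w₀, hw₀, hmin⟩ := (isCompact_sphere (0 : Euc k) 1).exists_isMinOn h hcont.continuousOn
  have hpos : 0 < N w₀ := (apply_nonneg N w₀).lt_of_ne' fun h => by
    rw [hN w₀ h] at hw₀; simp at hw₀
  refine ⟨(N w₀)⁻¹, inv_nonneg.2 hpos.le, fun w => ?_⟩
  rcases eq_or_ne w 0 with rfl | hw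
  · simp
  have hw' : 0 < ‖w‖ := norm_pos_iff.2 hw
  have h1 : N w₀ ≤ N (‖w‖⁻¹ • w) := hmin (by
    rw [mem_sphere_zero_iff_norm, norm_smul, norm_inv, norm_norm, inv_mul_cancel₀ hw'.ne'])
  rw [map_smul_eq_mul, norm_inv, norm_norm, inv_mul_eq_div, le_div_iff₀ hw'] at h1
  rw [inv_mul_eq_div, le_div_iff₀ hpos]
  linarith

theorem abs_apply_le_mul_of_norm_le {k : ℕ} {N : Seminorm ℝ (Euc k)} {C : ℝ}
    (hC : ∀ w, ‖w‖ ≤ C * N w) (w : Euc k) (i : Fin k) : |w i| ≤ C * N w :=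
  (PiLp.norm_apply_le w i).trans (hC w)

theorem zero_mem_complSet : (0 : Euc 2) ∈ complSet := by simp [complSet]

instance : Nonempty complSet := ⟨⟨0, zero_mem_complSet⟩⟩

theorem distCompl_nonneg (N : Seminorm ℝ (Euc 2)) (a b : ℝ) : 0 ≤ distCompl N a b :=
  Real.iInf_nonneg fun _ => apply_nonneg N _

theorem distCompl_eq_zero (N : Seminorm ℝ (Euc 2)) {a b : ℝ} (ha : 0 ≤ a) (hb : 0 ≤ b)
    (hab : a * b = 0) : distCompl N a b = 0 := by
  refine le_antisymm ?_ (distCompl_nonneg N a b)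
  refine (ciInf_le ⟨0, ?_⟩ (⟨!₂[a, b], ha, hb, hab⟩ : complSet)).trans ?_
  · rintro _ ⟨w, rfl⟩
    exact apply_nonneg N _
  · simp

/-- Each point of the complementarity set has a zero coordinate, so its distance to `(a, b)`
controls `|a|` or `|b|`. -/
theorem min_abs_le_mul_distCompl {N : Seminorm ℝ (Euc 2)} {C : ℝ} (hC0 : 0 ≤ C)
    (hC : ∀ w, ‖w‖ ≤ C * N w) (a b : ℝ) : min |a| |b| ≤ C * distCompl N a b := by
  rw [distCompl, Real.mul_iInf_of_nonneg hC0]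
  refine le_ciInf fun w => ?_
  rcases mul_eq_zero.1 w.2.2.2 with h | h
  · refine (min_le_left _ _).trans ?_
    simpa [h] using abs_apply_le_mul_of_norm_le hC (!₂[a, b] - (w : Euc 2)) 0
  · refine (min_le_right _ _).trans ?_
    simpa [h] using abs_apply_le_mul_of_norm_le hC (!₂[a, b] - (w : Euc 2)) 1

/-! ### Coordinates and derivatives on the space of `(x, y, u, v)` -/

namespace CPSpace

variable {d s m n : ℕ}

/-- The projection `(x, y, u, v) ↦ (x, y)`. -/
def xyL : CPSpace d s m n →L[ℝ] Euc d × Euc s :=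
  LinearMap.toContinuousLinearMap
    { toFun := CPSpace.xy
      map_add' := fun _ _ => rfl
      map_smul' := fun _ _ => rfl }

/-- The projection `(x, y, u, v) ↦ x`. -/
def xL : CPSpace d s m n →L[ℝ] Euc d :=
  (ContinuousLinearMap.fst ℝ (Euc d) (Euc s)).comp xyL

/-- The projection `(x, y, u, v) ↦ u i`. -/
def uL (i : Fin m) : CPSpace d s m n →L[ℝ] ℝ :=
  EuclideanSpace.proj (Sum.inr (Sum.inr (Sum.inl i)))

/-- The projection `(x, y, u, v) ↦ v j`. -/
def vL (j : Fin n) : CPSpace d s m n →L[ℝ] ℝ :=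
  EuclideanSpace.proj (Sum.inr (Sum.inr (Sum.inr j)))

theorem contDiff_xy {k : WithTop ℕ∞} : ContDiff ℝ k (CPSpace.xy : CPSpace d s m n → _) :=
  (xyL (d := d) (s := s) (m := m) (n := n)).contDiff

theorem continuous_xy : Continuous (CPSpace.xy : CPSpace d s m n → _) :=
  (xyL (d := d) (s := s) (m := m) (n := n)).continuous

theorem contDiff_u {k : WithTop ℕ∞} (i : Fin m) :
    ContDiff ℝ k fun z : CPSpace d s m n => z.u i :=
  (uL i).contDiff

theorem contDiff_v {k : WithTop ℕ∞} (j : Fin n) :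
    ContDiff ℝ k fun z : CPSpace d s m n => z.v j :=
  (vL j).contDiff

theorem fderiv_comp_xy {φ : Euc d × Euc s → ℝ} (hφ : Differentiable ℝ φ)
    (z w : CPSpace d s m n) :
    fderiv ℝ (fun z : CPSpace d s m n => φ z.xy) z w = fderiv ℝ φ z.xy w.xy := by
  have h : HasFDerivAt (fun z : CPSpace d s m n => φ z.xy) ((fderiv ℝ φ z.xy).comp xyL) z :=
    (hφ z.xy).hasFDerivAt.comp z xyL.hasFDerivAt
  rw [h.fderiv]; rfl

theorem fderiv_u (i : Fin m) (z w : CPSpace d s m n) :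
    fderiv ℝ (fun z : CPSpace d s m n => z.u i) z w = w.u i :=
  congrArg (· w) (uL i).hasFDerivAt.fderiv

/-- The coordinates of `(x, y)`. -/
def coordXY (w : CPSpace d s m n) : Fin d ⊕ Fin s → ℝ := Sum.elim w.x w.y

end CPSpace

/-- Translates a row of partial derivatives in `matJ` into a Fréchet derivative along `w`. -/
theorem sum_partialXY_mul {d s m n : ℕ} (φ : Euc d × Euc s → ℝ) (p : Euc d × Euc s)
    (w : CPSpace d s m n) :
    ∑ c, partialXY φ p c * w.coordXY c = fderiv ℝ φ p w.xy := by
  have h : w.xy = ∑ i, w.x i • (EuclideanSpace.single i (1 : ℝ), (0 : Euc s))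
      + ∑ k, w.y k • ((0 : Euc d), EuclideanSpace.single k (1 : ℝ)) := by
    have hx : ∀ {k : ℕ} (a : Euc k), a = ∑ i, a i • EuclideanSpace.single i (1 : ℝ) := fun a => by
      simpa using ((EuclideanSpace.basisFun _ ℝ).sum_repr a).symm
    refine Prod.ext ?_ ?_
    · simpa [Prod.fst_sum, CPSpace.xy] using hx w.x
    · simpa [Prod.snd_sum, CPSpace.xy] using hx w.y
  rw [h]
  simp only [map_add, map_sum, map_smul, smul_eq_mul, Fintype.sum_sum_type, partialXY,
    CPSpace.coordXY, Sum.elim_inl, Sum.elim_inr]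
  congr 1 <;> exact Finset.sum_congr rfl fun i _ => mul_comm _ _

/-! ### The constraint system of the combined program and its Jacobian -/

namespace Bilevel

variable {d s p q m n : ℕ} {P : Bilevel d s p q m n}

/-- The feasible points of the combined program at which `V` is finite are feasible for its
system of constraints. -/
theorem feasible_cpSystem {z : CPSpace d s m n} (hz : z ∈ P.cpFeasible)
    (hbot : P.value z.x ≠ ⊥) (htop : P.value z.x ≠ ⊤) : P.cpSystem.Feasible z := by
  obtain ⟨hfV, hG, hH, hh, hL, hc⟩ := hz
  refine ⟨?_, ?_, hc⟩
  · rintro (_ | i)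
    · rw [← EReal.coe_toReal htop hbot, EReal.coe_le_coe_iff] at hfV
      exact sub_nonpos.2 hfV
    · exact hG i
  · rintro (j | j | k)
    · exact hH j
    · exact hh j
    · exact congrArg (fun a : Euc s => a k) hL

theorem setI_cpSystem (z : CPSpace d s m n) : P.cpSystem.setI z = P.idxI z := by
  ext i; simp [FeasSystem.setI, idxI, cpSystem]

theorem setK_cpSystem (z : CPSpace d s m n) : P.cpSystem.setK z = P.idxK z := by
  ext i; simp [FeasSystem.setK, idxK, cpSystem]

theorem mem_idx_cases {z : CPSpace d s m n} (hz : P.cpSystem.Feasible z) (i : Fin m) :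
    i ∈ P.idxI z ∪ P.idxJ z ∨ i ∈ P.idxK z := by
  obtain ⟨h1, h2, h3⟩ := hz.2.2 i
  simp only [cpSystem] at h1 h2 h3
  simp only [idxI, idxJ, idxK, Finset.mem_union, Finset.mem_filter, Finset.mem_univ, true_and]
  rcases eq_or_ne (P.g i z.xy) 0 with hg | hg
  · rcases h2.eq_or_lt with hu | hu
    · exact Or.inl (Or.inr ⟨hg, hu.symm⟩)
    · exact Or.inl (Or.inl ⟨hg, hu⟩)
  · have : z.u i = 0 := (mul_eq_zero.1 h3).resolve_left (neg_ne_zero.2 hg)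
    exact Or.inr ⟨lt_of_le_of_ne (by linarith) hg, this⟩

/-- This count turns the rank hypothesis into full column rank of `matJ`. -/
theorem card_idx {z : CPSpace d s m n} (hz : P.cpSystem.Feasible z) :
    (P.idxI z ∪ P.idxJ z).card + (P.idxK z).card = m := by
  classical
  have hdisj : Disjoint (P.idxI z ∪ P.idxJ z) (P.idxK z) := by
    simp only [Finset.disjoint_left, idxI, idxJ, idxK, Finset.mem_union, Finset.mem_filter,
      Finset.mem_univ, true_and]
    rintro i (⟨h, -⟩ | ⟨h, -⟩) ⟨h', -⟩ <;> exact h'.ne h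
  rw [← Finset.card_union_of_disjoint hdisj]
  have : (P.idxI z ∪ P.idxJ z) ∪ P.idxK z = Finset.univ :=
    Finset.eq_univ_of_forall fun i => Finset.mem_union.2 (mem_idx_cases hz i)
  simp [this]

theorem contDiff_gradYL (hfy : ContDiff ℝ 1 (gradY P.f)) (hgy : ∀ i, ContDiff ℝ 1 (gradY (P.g i)))
    (hhy : ∀ j, ContDiff ℝ 1 (gradY (P.h j))) :
    ContDiff ℝ 1 fun z : CPSpace d s m n => P.gradYL z.xy z.u z.v := by
  refine ((hfy.comp CPSpace.contDiff_xy).add (ContDiff.sum fun i _ => ?_)).add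
    (ContDiff.sum fun j _ => ?_)
  · exact (CPSpace.contDiff_u i).smul ((hgy i).comp CPSpace.contDiff_xy)
  · exact (CPSpace.contDiff_v j).smul ((hhy j).comp CPSpace.contDiff_xy)

/-- Product rule: the three summands correspond to the blocks in the first block row of `matJ`, the
first with multipliers frozen. -/
theorem fderiv_gradYL (hfy : ContDiff ℝ 1 (gradY P.f)) (hgy : ∀ i, ContDiff ℝ 1 (gradY (P.g i)))
    (hhy : ∀ j, ContDiff ℝ 1 (gradY (P.h j))) (k : Fin s) (z w : CPSpace d s m n) :
    fderiv ℝ (fun z : CPSpace d s m n => P.gradYL z.xy z.u z.v k) z w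
      = fderiv ℝ (fun p => P.gradYL p z.u z.v k) z.xy w.xy
        + ∑ i, w.u i * gradY (P.g i) z.xy k + ∑ j, w.v j * gradY (P.h j) z.xy k := by
  have hcoord : ∀ {φ : Euc d × Euc s → Euc s}, ContDiff ℝ 1 φ → Differentiable ℝ fun p => φ p k :=
    fun h => (EuclideanSpace.proj (𝕜 := ℝ) k).differentiable.comp (h.differentiable one_ne_zero)
  have hf' := (hcoord hfy z.xy).hasFDerivAt
  have hg' := fun i => (hcoord (hgy i) z.xy).hasFDerivAt
  have hh' := fun j => (hcoord (hhy j) z.xy).hasFDerivAt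
  have hxy : HasFDerivAt CPSpace.xy CPSpace.xyL z := CPSpace.xyL.hasFDerivAt
  have hu : ∀ i, HasFDerivAt (fun z : CPSpace d s m n => z.u i) (CPSpace.uL i) z :=
    fun i => (CPSpace.uL i).hasFDerivAt
  have hv : ∀ j, HasFDerivAt (fun z : CPSpace d s m n => z.v j) (CPSpace.vL j) z :=
    fun j => (CPSpace.vL j).hasFDerivAt
  have hL : HasFDerivAt (fun z : CPSpace d s m n => gradY P.f z.xy k
        + ∑ i, z.u i * gradY (P.g i) z.xy k + ∑ j, z.v j * gradY (P.h j) z.xy k) _ z :=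
    ((hf'.comp z hxy).add (HasFDerivAt.fun_sum fun i _ => (hu i).mul ((hg' i).comp z hxy))).add
      (HasFDerivAt.fun_sum fun j _ => (hv j).mul ((hh' j).comp z hxy))
  have hR : HasFDerivAt (fun p => gradY P.f p k
        + ∑ i, z.u i * gradY (P.g i) p k + ∑ j, z.v j * gradY (P.h j) p k) _ z.xy :=
    (hf'.add (HasFDerivAt.fun_sum fun i _ => (hg' i).const_mul (z.u i))).add
      (HasFDerivAt.fun_sum fun j _ => (hh' j).const_mul (z.v j))
  have e : ∀ (p : Euc d × Euc s) (u : Euc m) (v : Euc n), P.gradYL p u v k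
      = gradY P.f p k + ∑ i, u i * gradY (P.g i) p k + ∑ j, v j * gradY (P.h j) p k := by
    intro p u v
    simp [gradYL, Finset.sum_apply]
  have hxyw : CPSpace.xyL w = w.xy := rfl
  have huw : ∀ i, CPSpace.uL i w = w.u i := fun _ => rfl
  have hvw : ∀ j, CPSpace.vL j w = w.v j := fun _ => rfl
  simp only [e]
  rw [hL.fderiv, hR.fderiv]
  simp only [add_apply, sum_apply, smul_apply, ContinuousLinearMap.comp_apply, smul_eq_mul,
    Finset.sum_add_distrib, hxyw, huw, hvw, Function.comp_apply]
  simp only [mul_comm]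
  ring

/-- The coordinates of `w` other than those of `u` over `idxK` form a vector in the kernel of
`matJ`, which is trivial; the omitted coordinates vanish since the `u i`, `i ∈ idxK`, belong to the
family. -/
theorem eq_zero_of_fderiv_eq_zero (hH : ∀ j, ContDiff ℝ 1 (P.H j))
    (hg : ∀ i, ContDiff ℝ 1 (P.g i)) (hh : ∀ j, ContDiff ℝ 1 (P.h j))
    (hfy : ContDiff ℝ 1 (gradY P.f)) (hgy : ∀ i, ContDiff ℝ 1 (gradY (P.g i)))
    (hhy : ∀ j, ContDiff ℝ 1 (gradY (P.h j))) {z₀ : CPSpace d s m n}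
    (hz : P.cpSystem.Feasible z₀)
    (hrank : (P.matJ z₀).rank + (P.idxK z₀).card = d + s + m + n) (w : CPSpace d s m n)
    (hw : ∀ a, fderiv ℝ (P.cpSystem.funFamily Finset.univ (P.cpSystem.setI z₀)
      (P.cpSystem.setK z₀) a) z₀ w = 0) : w = 0 := by
  classical
  have hwh : ∀ j, fderiv ℝ (P.cpSystem.h j) z₀ w = 0 := fun j =>
    hw (Sum.inl ⟨j, Finset.mem_univ j⟩)
  have hwH : ∀ j, fderiv ℝ (P.H j) z₀.xy w.xy = 0 := fun j => by
    rw [← CPSpace.fderiv_comp_xy ((hH j).differentiable one_ne_zero)]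
    exact hwh (Sum.inl j)
  have hwlh : ∀ j, fderiv ℝ (P.h j) z₀.xy w.xy = 0 := fun j => by
    rw [← CPSpace.fderiv_comp_xy ((hh j).differentiable one_ne_zero)]
    exact hwh (Sum.inr (Sum.inl j))
  have hwg : ∀ i ∈ P.idxI z₀, fderiv ℝ (P.g i) z₀.xy w.xy = 0 := fun i hi => by
    rw [← CPSpace.fderiv_comp_xy ((hg i).differentiable one_ne_zero)]
    have h : fderiv ℝ (fun z : CPSpace d s m n => -P.g i z.xy) z₀ w = 0 :=
      hw (Sum.inr (Sum.inl ⟨i, setI_cpSystem (P := P) z₀ ▸ hi⟩))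
    rw [fderiv_fun_neg] at h
    exact neg_eq_zero.1 h
  have hwu : ∀ i ∈ P.idxK z₀, w.u i = 0 := fun i hi => by
    rw [← CPSpace.fderiv_u i z₀ w]
    exact hw (Sum.inr (Sum.inr ⟨i, setK_cpSystem (P := P) z₀ ▸ hi⟩))
  have hwL : ∀ k, fderiv ℝ (fun p => P.gradYL p z₀.u z₀.v k) z₀.xy w.xy
        + ∑ i, w.u i * gradY (P.g i) z₀.xy k + ∑ j, w.v j * gradY (P.h j) z₀.xy k = 0 := fun k => by
    rw [← fderiv_gradYL hfy hgy hhy]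
    exact hwh (Sum.inr (Sum.inr k))
  -- Rank-nullity: the number of columns is `d + s + n` plus the cardinality of `idxI ∪ idxJ`, which
  -- equals the rank.
  have hinj : Function.Injective (P.matJ z₀).mulVecLin := by
    rw [← LinearMap.ker_eq_bot, ← Submodule.finrank_eq_zero]
    have h := (P.matJ z₀).mulVecLin.finrank_range_add_finrank_ker
    have hrk : (P.matJ z₀).rank = Module.finrank ℝ (LinearMap.range (P.matJ z₀).mulVecLin) := rfl
    simp only [Module.finrank_pi, Fintype.card_sum, Fintype.card_fin, Fintype.card_coe] at h
    have hcard := card_idx hz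
    omega
  have hrow : ∀ r (φ : Euc d × Euc s → ℝ),
      (∀ c, P.matJ z₀ r (Sum.inl c) = partialXY φ z₀.xy c) →
      (∀ b, P.matJ z₀ r (Sum.inr b) = 0) → fderiv ℝ φ z₀.xy w.xy = 0 →
      (P.matJ z₀).mulVec (Sum.elim w.coordXY (Sum.elim w.v fun i => w.u i)) r = 0 := by
    intro r φ h1 h2 h3
    rw [Matrix.mulVec, dotProduct, Fintype.sum_sum_type]
    simp only [h1, h2, Sum.elim_inl, zero_mul, Finset.sum_const_zero, add_zero]
    rw [sum_partialXY_mul, h3]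
  have hmul : (P.matJ z₀).mulVec (Sum.elim w.coordXY (Sum.elim w.v fun i => w.u i)) = 0 := by
    ext (k | j | j | i)
    · rw [Matrix.mulVec, dotProduct, Fintype.sum_sum_type]
      refine (congrArg₂ (· + ·) (sum_partialXY_mul (fun p => P.gradYL p z₀.u z₀.v k) z₀.xy w)
        (Fintype.sum_sum_type _)).trans ?_
      simp only [matJ, Sum.elim_inl, Sum.elim_inr, Pi.zero_apply]
      rw [← hwL k, add_assoc, add_comm (∑ i, w.u i * _)]
      congr 2
      · exact Finset.sum_congr rfl fun j _ => mul_comm _ _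
      -- The matrix has columns only over `idxI ∪ idxJ`; the missing terms contain `w.u i = 0`.
      · rw [Finset.sum_coe_sort (P.idxI z₀ ∪ P.idxJ z₀) fun i => gradY (P.g i) z₀.xy k * w.u i]
        rw [Finset.sum_subset (Finset.subset_univ _) fun i _ hi => by
          rw [hwu i ((mem_idx_cases hz i).resolve_left hi), mul_zero]]
        exact Finset.sum_congr rfl fun i _ => mul_comm _ _
    · exact hrow _ (P.h j) (fun _ => rfl) (fun b => by rcases b with b | b <;> rfl) (hwlh j)
    · exact hrow _ (P.H j) (fun _ => rfl) (fun b => by rcases b with b | b <;> rfl) (hwH j)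
    · exact hrow _ (P.g i) (fun _ => rfl) (fun b => by rcases b with b | b <;> rfl) (hwg i i.2)
  have h0 := hinj (hmul.trans (map_zero (P.matJ z₀).mulVecLin).symm)
  ext (i | k | i | j)
  · exact congrFun h0 (Sum.inl (Sum.inl i))
  · exact congrFun h0 (Sum.inl (Sum.inr k))
  · rcases mem_idx_cases hz i with hi | hi
    · exact congrFun h0 (Sum.inr (Sum.inr ⟨i, hi⟩))
    · exact hwu i hi
  · exact congrFun h0 (Sum.inr (Sum.inl j))

theorem contDiff_funFamily (hH : ∀ j, ContDiff ℝ 1 (P.H j))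
    (hg : ∀ i, ContDiff ℝ 1 (P.g i)) (hh : ∀ j, ContDiff ℝ 1 (P.h j))
    (hfy : ContDiff ℝ 1 (gradY P.f)) (hgy : ∀ i, ContDiff ℝ 1 (gradY (P.g i)))
    (hhy : ∀ j, ContDiff ℝ 1 (gradY (P.h j))) (A : Finset (Fin q ⊕ Fin n ⊕ Fin s))
    (B D : Finset (Fin m)) (a) : ContDiff ℝ 1 (P.cpSystem.funFamily A B D a) := by
  rcases a with ⟨j | j | k, -⟩ | i | i
  · exact (hH j).comp CPSpace.contDiff_xy
  · exact (hh j).comp CPSpace.contDiff_xy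
  · exact (EuclideanSpace.proj (𝕜 := ℝ) k).contDiff.comp (contDiff_gradYL hfy hgy hhy)
  · exact ((hg i).comp CPSpace.contDiff_xy).neg
  · exact CPSpace.contDiff_u _

theorem limitingSubdiff_cpSystem_g_nonempty (hG : ∀ i, ContDiff ℝ 1 (P.G i))
    (hf : ContDiff ℝ 1 P.f) {z₀ : CPSpace d s m n} (hV : LipschitzNear P.value z₀.x)
    (i : Unit ⊕ Fin p) : (limitingSubdiff (P.cpSystem.g i) z₀).Nonempty := by
  have hlip : ∀ {φ : Euc d × Euc s → ℝ}, ContDiff ℝ 1 φ →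
      ∃ K, ∃ t ∈ 𝓝 z₀, LipschitzOnWith K (fun z : CPSpace d s m n => φ z.xy) t := fun h =>
    (h.comp CPSpace.contDiff_xy).locallyLipschitz z₀
  rcases i with _ | i
  · obtain ⟨K, t, ht, hK⟩ := hlip hf
    obtain ⟨U, hU, -, K', hK'⟩ := hV
    have hcomp : LipschitzOnWith (K' * ‖CPSpace.xL‖₊)
        (fun z : CPSpace d s m n => (P.value z.x).toReal) (CPSpace.xL ⁻¹' U) :=
      hK'.comp CPSpace.xL.lipschitz.lipschitzOnWith (Set.mapsTo_preimage _ _)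
    have hU' : CPSpace.xL ⁻¹' U ∈ 𝓝 z₀ := CPSpace.xL.continuous.continuousAt hU
    exact limitingSubdiff_nonempty (inter_mem ht hU')
      ((hK.mono Set.inter_subset_left).sub (hcomp.mono Set.inter_subset_right))
  · obtain ⟨K, t, ht, hK⟩ := hlip (hG i)
    exact limitingSubdiff_nonempty ht hK

/-! ### Comparison of the penalty with the equality residuals -/

section Penalty

variable {N : ∀ k, Seminorm ℝ (Euc k)}

theorem penalty_eq_zero {z : CPSpace d s m n} (hz : P.cpSystem.Feasible z) :
    P.penalty N z = 0 := by
  obtain ⟨h1, h2, h3⟩ := hz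
  have hfV : P.f z.xy - (P.value z.x).toReal ≤ 0 := h1 (Sum.inl ())
  have hG : ∀ i, P.G i z.xy ≤ 0 := fun i => h1 (Sum.inr i)
  have hH : ∀ j, P.H j z.xy = 0 := fun j => h2 (Sum.inl j)
  have hh : ∀ j, P.h j z.xy = 0 := fun j => h2 (Sum.inr (Sum.inl j))
  have hL : P.gradYL z.xy z.u z.v = 0 := by ext k; exact h2 (Sum.inr (Sum.inr k))
  have hc : ∀ i, distCompl (N 2) (-P.g i z.xy) (z.u i) = 0 := fun i =>
    distCompl_eq_zero _ (h3 i).1 (h3 i).2.1 (h3 i).2.2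
  have hzero : ∀ k, (WithLp.toLp 2 fun _ => 0 : Euc k) = 0 := fun _ => rfl
  simp [penalty, hfV, hG, hH, hh, hL, hc, hzero]

theorem distCompl_le_penalty (z : CPSpace d s m n) (i : Fin m) :
    distCompl (N 2) (-P.g i z.xy) (z.u i) ≤ P.penalty N z := by
  have := Finset.single_le_sum (f := fun i => distCompl (N 2) (-P.g i z.xy) (z.u i))
    (fun _ _ => distCompl_nonneg _ _ _) (Finset.mem_univ i)
  refine this.trans (le_add_of_nonneg_left ?_)
  positivity

theorem norm_H_le_penalty (z : CPSpace d s m n) :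
    N q (WithLp.toLp 2 fun j => P.H j z.xy) ≤ P.penalty N z := by
  have h1 : 0 ≤ ∑ i, distCompl (N 2) (-P.g i z.xy) (z.u i) :=
    Finset.sum_nonneg fun _ _ => distCompl_nonneg _ _ _
  have h2 := le_max_right (P.f z.xy - (P.value z.x).toReal) 0
  have h3 := apply_nonneg (N n) (WithLp.toLp 2 fun j => P.h j z.xy)
  have h4 := apply_nonneg (N p) (WithLp.toLp 2 fun i => max (P.G i z.xy) 0)
  have h5 := apply_nonneg (N s) (P.gradYL z.xy z.u z.v)
  unfold penalty
  linarith

theorem norm_h_le_penalty (z : CPSpace d s m n) :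
    N n (WithLp.toLp 2 fun j => P.h j z.xy) ≤ P.penalty N z := by
  have h1 : 0 ≤ ∑ i, distCompl (N 2) (-P.g i z.xy) (z.u i) :=
    Finset.sum_nonneg fun _ _ => distCompl_nonneg _ _ _
  have h2 := le_max_right (P.f z.xy - (P.value z.x).toReal) 0
  have h3 := apply_nonneg (N q) (WithLp.toLp 2 fun j => P.H j z.xy)
  have h4 := apply_nonneg (N p) (WithLp.toLp 2 fun i => max (P.G i z.xy) 0)
  have h5 := apply_nonneg (N s) (P.gradYL z.xy z.u z.v)
  unfold penalty
  linarith

theorem norm_gradYL_le_penalty (z : CPSpace d s m n) :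
    N s (P.gradYL z.xy z.u z.v) ≤ P.penalty N z := by
  have h1 : 0 ≤ ∑ i, distCompl (N 2) (-P.g i z.xy) (z.u i) :=
    Finset.sum_nonneg fun _ _ => distCompl_nonneg _ _ _
  have h2 := le_max_right (P.f z.xy - (P.value z.x).toReal) 0
  have h3 := apply_nonneg (N q) (WithLp.toLp 2 fun j => P.H j z.xy)
  have h4 := apply_nonneg (N p) (WithLp.toLp 2 fun i => max (P.G i z.xy) 0)
  have h5 := apply_nonneg (N n) (WithLp.toLp 2 fun j => P.h j z.xy)
  unfold penalty
  linarith

/-- Near `z₀` the penalty dominates the equality constraints, including those given by the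
complementarity conditions that are strict at `z₀`. -/
theorem eventually_abs_funFamily_le_penalty (hg : ∀ i, ContDiff ℝ 1 (P.g i))
    (hN : ∀ k w, N k w = 0 → w = 0) (z₀ : CPSpace d s m n) (a) :
    ∃ C : ℝ, 0 ≤ C ∧ ∀ᶠ z in 𝓝 z₀,
      |P.cpSystem.funFamily Finset.univ (P.cpSystem.setI z₀) (P.cpSystem.setK z₀) a z|
        ≤ C * P.penalty N z := by
  have hgc : ∀ i, Continuous fun z : CPSpace d s m n => |-P.g i z.xy| := fun i =>
    ((hg i).continuous.comp CPSpace.continuous_xy).neg.abs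
  have huc : ∀ i, Continuous fun z : CPSpace d s m n => |z.u i| := fun i =>
    (CPSpace.contDiff_u (k := 0) i).continuous.abs
  obtain ⟨C₂, hC₂, hC₂'⟩ := (N 2).exists_norm_le_mul (hN 2)
  rcases a with ⟨j | j | k, -⟩ | ⟨i, hi⟩ | ⟨i, hi⟩
  · obtain ⟨C, hC, hC'⟩ := (N q).exists_norm_le_mul (hN q)
    exact ⟨C, hC, Eventually.of_forall fun z => (abs_apply_le_mul_of_norm_le hC' _ j).trans
      (mul_le_mul_of_nonneg_left (norm_H_le_penalty z) hC)⟩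
  · obtain ⟨C, hC, hC'⟩ := (N n).exists_norm_le_mul (hN n)
    exact ⟨C, hC, Eventually.of_forall fun z => (abs_apply_le_mul_of_norm_le hC' _ j).trans
      (mul_le_mul_of_nonneg_left (norm_h_le_penalty z) hC)⟩
  · obtain ⟨C, hC, hC'⟩ := (N s).exists_norm_le_mul (hN s)
    exact ⟨C, hC, Eventually.of_forall fun z => (abs_apply_le_mul_of_norm_le hC' _ k).trans
      (mul_le_mul_of_nonneg_left (norm_gradYL_le_penalty z) hC)⟩
  · have hi' : -P.g i z₀.xy = 0 ∧ 0 < z₀.u i := by simpa [FeasSystem.setI, cpSystem] using hi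
    -- Strictness persists near `z₀`, so the minimum bounded by the distance is attained by the
    -- function that vanishes at `z₀`.
    have hlt : |-P.g i z₀.xy| < |z₀.u i| := by
      rw [hi'.1, abs_zero]; exact abs_pos.2 hi'.2.ne'
    refine ⟨C₂, hC₂, ((hgc i).continuousAt.eventually_lt (huc i).continuousAt hlt).mono
      fun z hz => ?_⟩
    calc |-P.g i z.xy| = min |-P.g i z.xy| |z.u i| := (min_eq_left hz.le).symm
      _ ≤ C₂ * distCompl (N 2) (-P.g i z.xy) (z.u i) := min_abs_le_mul_distCompl hC₂ hC₂' _ _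
      _ ≤ _ := mul_le_mul_of_nonneg_left (distCompl_le_penalty z i) hC₂
  · have hi' : 0 < -P.g i z₀.xy ∧ z₀.u i = 0 := by simpa [FeasSystem.setK, cpSystem] using hi
    have hlt : |z₀.u i| < |-P.g i z₀.xy| := by
      rw [hi'.2, abs_zero]; exact abs_pos.2 hi'.1.ne'
    refine ⟨C₂, hC₂, ((huc i).continuousAt.eventually_lt (hgc i).continuousAt hlt).mono
      fun z hz => ?_⟩
    calc |z.u i| = min |-P.g i z.xy| |z.u i| := (min_eq_right hz.le).symm
      _ ≤ C₂ * distCompl (N 2) (-P.g i z.xy) (z.u i) := min_abs_le_mul_distCompl hC₂ hC₂' _ _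
      _ ≤ _ := mul_le_mul_of_nonneg_left (distCompl_le_penalty z i) hC₂

end Penalty

end Bilevel

end
theorem theorem5p2 {d s p q m n : ℕ} (P : Bilevel d s p q m n)
    (hF : LocallyLipschitz P.F)
    (hG : ∀ i, ContDiff ℝ 1 (P.G i)) (hH : ∀ j, ContDiff ℝ 1 (P.H j))
    (hf : ContDiff ℝ 1 P.f) (hg : ∀ i, ContDiff ℝ 1 (P.g i)) (hh : ∀ j, ContDiff ℝ 1 (P.h j))
    (hfy : ContDiff ℝ 1 (gradY P.f)) (hgy : ∀ i, ContDiff ℝ 1 (gradY (P.g i)))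
    (hhy : ∀ j, ContDiff ℝ 1 (gradY (P.h j)))
    (z₀ : CPSpace d s m n)
    (hsol : P.IsLocalSolutionCP z₀)
    (hV : LipschitzNear P.value z₀.x)
    (hrank : (P.matJ z₀).rank + (P.idxK z₀).card = d + s + m + n) :
    P.cpSystem.RCPLD z₀ ∧
    P.cpSystem.MStationary (fun z => P.F z.xy) z₀ ∧
    ∀ N : ∀ k, Seminorm ℝ (Euc k), (∀ k w, N k w = 0 → w = 0) →
      ∃ μ : ℝ, 0 ≤ μ ∧ IsLocalMin (fun z => P.F z.xy + μ * P.penalty N z) z₀ := by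
  have hfeas : P.cpSystem.Feasible z₀ := by
    obtain ⟨U, hU, hfin, -⟩ := hV
    have := hfin _ (mem_of_mem_nhds hU)
    exact Bilevel.feasible_cpSystem hsol.1 this.1 this.2
  have hinj := Bilevel.eq_zero_of_fderiv_eq_zero hH hg hh hfy hgy hhy hfeas hrank
  have hsmooth := Bilevel.contDiff_funFamily hH hg hh hfy hgy hhy Finset.univ
    (P.cpSystem.setI z₀) (P.cpSystem.setK z₀)
  have hspan : Submodule.span ℝ (Set.range (P.cpSystem.gradFamily Finset.univ
      (P.cpSystem.setI z₀) (P.cpSystem.setK z₀) z₀)) = ⊤ := by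
    rw [FeasSystem.gradFamily_eq_gradient]
    exact span_range_gradient_eq_top hinj
  obtain ⟨L, t, ht, hL⟩ : ∃ L, ∃ t ∈ 𝓝 z₀,
      LipschitzOnWith L (fun z : CPSpace d s m n => P.F z.xy) t :=
    (hF.comp CPSpace.xyL.lipschitz.locallyLipschitz) z₀
  refine ⟨FeasSystem.rcpld_of_span_eq_top hfeas (fun a => ?_) hspan,
    FeasSystem.mStationary_of_span_eq_top hfeas (limitingSubdiff_nonempty ht hL)
      (fun i _ => Bilevel.limitingSubdiff_cpSystem_g_nonempty hG hf hV i) hspan,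
    fun N hN => ?_⟩
  · simp only [FeasSystem.gradFamily_eq_gradient, gradient]
    exact ((LinearIsometryEquiv.continuous _).comp
      ((hsmooth a).continuous_fderiv one_ne_zero)).continuousAt
  · obtain ⟨C, hC0, hC⟩ := exists_norm_sub_le_sum_abs
      (fun a => (hsmooth a).differentiable one_ne_zero z₀)
      (fun a => by
        rcases a with ⟨j, -⟩ | ⟨i, hi⟩ | ⟨i, hi⟩
        · exact hfeas.2.1 j
        · simp only [FeasSystem.setI, Finset.mem_filter] at hi
          exact hi.2.1
        · simp only [FeasSystem.setK, Finset.mem_filter] at hi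
          exact hi.2.2) hinj
    choose D hD0 hD using Bilevel.eventually_abs_funFamily_le_penalty hg hN z₀
    -- The factors are the Lipschitz constant of the objective, the error bound constant, and the
    -- total cost of bounding the residuals by the penalty.
    refine ⟨L * (C * ∑ a, D a), mul_nonneg L.2 (mul_nonneg hC0 (Finset.sum_nonneg fun a _ => hD0 a)),
      ?_⟩
    filter_upwards [ht, hC, eventually_all.2 hD] with z hz hCz hDz
    rw [Bilevel.penalty_eq_zero hfeas, mul_zero, add_zero]
    have h1 : P.F z₀.xy - P.F z.xy ≤ L * ‖z - z₀‖ := by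
      have := hL.dist_le_mul z hz z₀ (mem_of_mem_nhds ht)
      rw [Real.dist_eq, dist_eq_norm] at this
      linarith [neg_abs_le (P.F z.xy - P.F z₀.xy)]
    have h2 : ‖z - z₀‖ ≤ C * ((∑ a, D a) * P.penalty N z) := by
      refine hCz.trans (mul_le_mul_of_nonneg_left ?_ hC0)
      rw [Finset.sum_mul]
      exact Finset.sum_le_sum fun a _ => hDz a
    have h3 : L * ‖z - z₀‖ ≤ L * (C * ∑ a, D a) * P.penalty N z := by
      rw [mul_assoc, mul_assoc]
      exact mul_le_mul_of_nonneg_left h2 L.2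
    linarith
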